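/- For $d,n\ge 1$ with $nd$ even, let $\mathcal{G}_{n,d}$ be the random $d$-regular multigraph on $n$ labelled vertices given by the configuration model: each vertex emits $d$ distinct half-edges, the $nd$ half-edges are paired up uniformly at random, and each pair is glued into an edge (loops and multiple edges are allowed). The size of a graph is its number of vertices. Let $(\epsilon_d)_{d\ge 1}$ be a sequence of real numbers with $0<\epsilon_d\le 1$ for all $d$ and $\epsilon_d\to 0$ as $d\to\infty$, and put $\tau=\tau(n,d)=\epsilon_d\,\frac{\log d}{d}\,n$. For every $\epsilon>0$ there is a $d_0=d_0(\epsilon,\{\epsilon_d\})$ such that for every fixed $d\ge d_0$ the following holds with probability tending to $1$ as $n\to\infty$ (over $n$ with $nd$ even): every induced subgraph of $\mathcal{G}_{n,d}$ all of whose connected components have size at most $\tau$ has size at most $$(2+\epsilon)\,\frac{\log d}{d}\,n .$$ -/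

import Mathlib

open Filter Topology

/-- The half-edges: each of the `n` labelled vertices emits `d` distinct half-edges;
the first component of a half-edge is the vertex that emits it. -/
abbrev HalfEdge (n d : ℕ) : Type := Fin n × Fin d

/-- A pairing (perfect matching) of the `n * d` half-edges, given by the map that sends every
half-edge to its partner: an involution without fixed points. -/
abbrev Pairing (n d : ℕ) : Type :=
  {p : HalfEdge n d → HalfEdge n d // (∀ h, p (p h) = h) ∧ ∀ h, p h ≠ h}

/-- The `d`-regular multigraph on `n` labelled vertices obtained from a pairing by gluing paired
half-edges into full edges. An edge is the unordered pair of its two half-edges, so loops and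
multiple edges may occur. -/
def Pairing.toGraph {n d : ℕ} (p : Pairing n d) : Graph (Fin n) (Sym2 (HalfEdge n d)) where
  vertexSet := Set.univ
  IsLink e x y := ∃ h : HalfEdge n d, e = s(h, p.1 h) ∧ h.1 = x ∧ (p.1 h).1 = y
  isLink_symm := by
    rintro e -
    refine ⟨?_⟩
    rintro x y ⟨h, rfl, rfl, rfl⟩
    exact ⟨p.1 h, by rw [p.2.1, Sym2.eq_swap], rfl, by rw [p.2.1]⟩
  eq_or_eq_of_isLink_of_isLink := by
    rintro e x y v w ⟨h, rfl, rfl, rfl⟩ ⟨k, hk, rfl, rfl⟩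
    rcases Sym2.eq_iff.1 hk with ⟨h1, -⟩ | ⟨h1, -⟩
    · exact Or.inl (by rw [h1])
    · exact Or.inr (by rw [h1])
  left_mem_of_isLink := by
    intro e x y _
    exact Set.mem_univ x

/-- The vertex set of the connected component of `x` in a multigraph `G`
(for `x` a vertex of `G`): all the vertices that a walk from `x` can reach. -/
def Graph.componentOf {α β : Type*} (G : Graph α β) (x : α) : Set α :=
  {y | Relation.ReflTransGen G.Adj x y}

/-- All components of the multigraph `G` have size (number of vertices) at most `τ`. -/
def Graph.ComponentsSizeAtMost {α β : Type*} (G : Graph α β) (τ : ℝ) : Prop :=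
  ∀ x ∈ G.vertexSet, ((G.componentOf x).ncard : ℝ) ≤ τ

/-- `S` is a percolation set with clusters of size at most `τ` in `G`: `S` is a set of vertices of
`G` such that all components of the induced subgraph `G[S]` have size at most `τ`. -/
def Graph.IsPercolationSet {α β : Type*} (G : Graph α β) (τ : ℝ) (S : Set α) : Prop :=
  S ⊆ G.vertexSet ∧ (G.induce S).ComponentsSizeAtMost τ

/-- The probability that the random multigraph of the configuration model, which is obtained from a
uniformly random pairing of the half-edges, has the property `P`. It is meaningful when `n * d` is
even, which is exactly when pairings exist. -/
noncomputable def configProb (n d : ℕ)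
    (P : Graph (Fin n) (Sym2 (HalfEdge n d)) → Prop) : ℝ :=
  ({p : Pairing n d | P p.toGraph}.ncard : ℝ) / (Nat.card (Pairing n d) : ℝ)

/-- With high probability for the random `d`-regular multigraphs of the configuration model:
the probability tends to `1` as `n → ∞` with `n * d` even. -/
def ConfigWHP (d : ℕ)
    (P : ∀ n : ℕ, Graph (Fin n) (Sym2 (HalfEdge n d)) → Prop) : Prop :=
  Tendsto (fun n : ℕ => configProb n d (P n)) (atTop ⊓ 𝓟 {n : ℕ | Even (n * d)}) (𝓝 1)

/-! No edge joins two components of an induced subgraph, so a set with components of size at most τ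
is sparse as soon as all sets of at most τ vertices are. Put L = log d and let t lie between δL and
2δL, with δ small in terms of ε.

Small sets: s ≤ τ vertices span on average about ds²/(2n) ≤ ε_d Ls/2 edges, far below ts because ε_d
→ 0. A union bound shows that with high probability all of them span fewer than ts edges. Hence a
percolation set S spans at most t|S| edges.

Large sets: for k just above (2+ε)(L/d)n the mean is at least (1+ε/2)kL, and at most tk edges occur
with probability at most exp(1/2 - (1+ε/8)kL). This beats the number of k-sets, which is at most
exp(kL), so no k-set is that sparse.

Both tails come from `pairingSum_le`, a Poisson-type bound on the generating function of the number
of pairs inside a set, proved by revealing one partner at a time. It gives `card_dense_le` and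
`card_sparse_le`; the two regimes meet in `exists_dense_or_sparse`, through
`internalCount_le_of_isPercolationSet`. -/

/-- The involutions of `α` whose set of non-fixed points is `V`. -/
def pairingsOn {α : Type*} [Fintype α] [DecidableEq α] (V : Finset α) : Finset (α → α) :=
  {p | (∀ h, p (p h) = h) ∧ ∀ h, p h ≠ h ↔ h ∈ V}

/-- The number of elements of `A` that `p` maps into `A`. -/
def internalCount {α : Type*} [DecidableEq α] (p : α → α) (A : Finset α) : ℕ :=
  (A.filter fun h => p h ∈ A).card

/-! ### Generating function of the pairs inside a set -/

section Counting

variable {α : Type*} [Fintype α] [DecidableEq α]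

theorem mem_pairingsOn {V : Finset α} {p : α → α} :
    p ∈ pairingsOn V ↔ (∀ h, p (p h) = h) ∧ ∀ h, p h ≠ h ↔ h ∈ V := by
  simp [pairingsOn]

/-- Composing with the transposition turns the pair {x, p x} into two fixed points. Encoding a
partial pairing as an involution with prescribed support keeps this removal inside one type. -/
theorem swap_comp_mem_pairingsOn {V : Finset α} {p : α → α} (hp : p ∈ pairingsOn V) {x : α}
    (hx : x ∈ V) : Equiv.swap x (p x) ∘ p ∈ pairingsOn ((V.erase x).erase (p x)) := by
  rw [mem_pairingsOn] at hp ⊢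
  obtain ⟨h1, h2⟩ := hp
  have hinj : ∀ a b, p a = p b → a = b := fun a b h => by rw [← h1 a, h, h1]
  have hne := (h2 x).2 hx
  have key : ∀ h, h ≠ x → h ≠ p x → (Equiv.swap x (p x) ∘ p) h = p h := by
    intro h ha hb
    refine Equiv.swap_apply_of_ne_of_ne (fun hc => hb ?_) (fun hc => ha (hinj _ _ hc))
    rw [← hc, h1]
  have kx : (Equiv.swap x (p x) ∘ p) x = x := by simp
  have ky : (Equiv.swap x (p x) ∘ p) (p x) = p x := by simp [h1]
  constructor
  · intro h
    by_cases ha : h = x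
    · rw [ha, kx, kx]
    by_cases hb : h = p x
    · rw [hb, ky, ky]
    rw [key h ha hb, key, h1]
    · intro hc; apply hb; rw [← hc, h1]
    · intro hc; exact ha (hinj _ _ hc)
  · intro h
    by_cases ha : h = x
    · rw [ha, kx]; simp
    by_cases hb : h = p x
    · rw [hb, ky]; simp
    rw [key h ha hb, h2]; simp [ha, hb]

theorem swap_comp_mem_pairingsOn' {V : Finset α} {q : α → α} {x y : α} (hx : x ∈ V) (hy : y ∈ V)
    (hxy : y ≠ x) (hq : q ∈ pairingsOn ((V.erase x).erase y)) :
    Equiv.swap x y ∘ q ∈ pairingsOn V ∧ (Equiv.swap x y ∘ q) x = y := by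
  rw [mem_pairingsOn] at hq ⊢
  obtain ⟨h1, h2⟩ := hq
  have hinj : ∀ a b, q a = q b → a = b := fun a b h => by rw [← h1 a, h, h1]
  have qx : q x = x := by by_contra hc; simpa using (h2 x).1 hc
  have qy : q y = y := by by_contra hc; simpa using (h2 y).1 hc
  have key : ∀ h, h ≠ x → h ≠ y → (Equiv.swap x y ∘ q) h = q h := by
    intro h ha hb
    refine Equiv.swap_apply_of_ne_of_ne (fun hc => ha ?_) (fun hc => hb ?_)
    · exact hinj _ _ (hc.trans qx.symm)
    · exact hinj _ _ (hc.trans qy.symm)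
  have kx : (Equiv.swap x y ∘ q) x = y := by simp [qx]
  have ky : (Equiv.swap x y ∘ q) y = x := by simp [qy]
  refine ⟨⟨?_, ?_⟩, kx⟩
  · intro h
    by_cases ha : h = x
    · rw [ha, kx, ky]
    by_cases hb : h = y
    · rw [hb, ky, kx]
    rw [key h ha hb, key, h1]
    · intro hc; exact ha (hinj _ _ (hc.trans qx.symm))
    · intro hc; exact hb (hinj _ _ (hc.trans qy.symm))
  · intro h
    by_cases ha : h = x
    · rw [ha, kx]; simp [hx, hxy]
    by_cases hb : h = y
    · rw [hb, ky]; simp [hy, hxy.symm]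
    rw [key h ha hb, h2]; simp [ha, hb]

theorem internalCount_eq_add {V A : Finset α} {p : α → α} (hp : p ∈ pairingsOn V)
    {x : α} (hxV : x ∈ V) (hx : x ∈ A) :
    internalCount p A = internalCount (Equiv.swap x (p x) ∘ p) ((A.erase x).erase (p x)) +
      if p x ∈ A then 2 else 0 := by
  obtain ⟨h1, h2⟩ := mem_pairingsOn.1 hp
  have hinj : ∀ a b, p a = p b → a = b := fun a b h => by rw [← h1 a, h, h1]
  have hne := (h2 x).2 hxV
  have hE : (((A.erase x).erase (p x)).filter fun h =>
      (Equiv.swap x (p x) ∘ p) h ∈ (A.erase x).erase (p x)) =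
      ((A.filter fun h => p h ∈ A).erase x).erase (p x) := by
    ext h
    simp only [Finset.mem_filter, Finset.mem_erase]
    by_cases ha : h = x
    · simp [ha]
    by_cases hb : h = p x
    · simp [hb]
    have e1 : p h ≠ x := fun hc => hb (by rw [← hc, h1])
    have e2 : p h ≠ p x := fun hc => ha (hinj _ _ hc)
    have : (Equiv.swap x (p x) ∘ p) h = p h := Equiv.swap_apply_of_ne_of_ne e1 e2
    rw [this]
    tauto
  unfold internalCount
  rw [hE]
  split_ifs with hy
  · have m1 : x ∈ A.filter fun h => p h ∈ A := by simp [hx, hy]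
    have m2 : p x ∈ (A.filter fun h => p h ∈ A).erase x := by simp [hx, hy, h1, hne]
    have := Finset.card_erase_add_one m1
    have := Finset.card_erase_add_one m2
    omega
  · rw [Finset.erase_eq_of_notMem, Finset.erase_eq_of_notMem]
    · rfl
    · simp [hy]
    · simp [hy]

/-- The generating function of `internalCount` over the pairings of `V`. -/
def pairingSum (w : ℝ) (V A : Finset α) : ℝ := ∑ p ∈ pairingsOn V, w ^ internalCount p A

/-- Condition on the partner y of x: if y lies in A, the pair contributes two half-edges to the
count, hence w ^ 2. -/
theorem pairingSum_eq_sum (w : ℝ) {V A : Finset α} {x : α} (hxV : x ∈ V) (hx : x ∈ A) :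
    pairingSum w V A = ∑ y ∈ V.erase x,
      (if y ∈ A then w ^ 2 else 1) *
        pairingSum w ((V.erase x).erase y) ((A.erase x).erase y) := by
  have hmaps : ∀ p ∈ pairingsOn V, p x ∈ V.erase x := by
    intro p hp
    obtain ⟨h1, h2⟩ := mem_pairingsOn.1 hp
    refine Finset.mem_erase.2 ⟨(h2 x).2 hxV, (h2 _).1 ?_⟩
    rw [h1]
    exact ((h2 x).2 hxV).symm
  unfold pairingSum
  rw [← Finset.sum_fiberwise_of_maps_to hmaps]
  refine Finset.sum_congr rfl fun y hy => ?_
  obtain ⟨hyx, hyV⟩ := Finset.mem_erase.1 hy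
  rw [Finset.mul_sum]
  refine Finset.sum_bij' (fun p _ => Equiv.swap x y ∘ p) (fun q _ => Equiv.swap x y ∘ q)
    ?_ ?_ ?_ ?_ ?_
  · intro p hp
    obtain ⟨hp', rfl⟩ := Finset.mem_filter.1 hp
    exact swap_comp_mem_pairingsOn hp' hxV
  · intro q hq
    exact Finset.mem_filter.2 (swap_comp_mem_pairingsOn' hxV hyV hyx hq)
  · intro p _; funext h; simp
  · intro p _; funext h; simp
  · intro p hp
    obtain ⟨hp', rfl⟩ := Finset.mem_filter.1 hp
    rw [internalCount_eq_add hp' hxV hx, pow_add, mul_comm]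
    split_ifs <;> simp

theorem pairingSum_one (V A : Finset α) : pairingSum 1 V A = (pairingsOn V).card := by
  simp [pairingSum]

theorem card_pairingsOn : ∀ (m : ℕ) {V : Finset α}, V.card = 2 * m →
    ((pairingsOn V).card : ℝ) = ∏ i ∈ Finset.range m, (2 * (i : ℝ) + 1) := by
  intro m
  induction m with
  | zero =>
    intro V hV
    have hV0 : V = ∅ := by simpa using hV
    have : pairingsOn V = {id} := by
      ext p
      rw [mem_pairingsOn, Finset.mem_singleton]
      constructor
      · rintro ⟨-, h⟩
        funext a
        simpa [hV0] using h a
      · rintro rfl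
        simp [hV0]
    simp [this]
  | succ m ih =>
    intro V hV
    obtain ⟨x, hx⟩ : V.Nonempty := Finset.card_pos.1 (by omega)
    rw [← pairingSum_one V V, pairingSum_eq_sum 1 hx hx, Finset.prod_range_succ, mul_comm]
    have : ∀ y ∈ V.erase x, (if y ∈ V then (1 : ℝ) ^ 2 else 1) *
        pairingSum 1 ((V.erase x).erase y) ((V.erase x).erase y) =
        ∏ i ∈ Finset.range m, (2 * (i : ℝ) + 1) := by
      intro y hy
      rw [pairingSum_one, ih]
      · simp
      · rw [Finset.card_erase_of_mem hy, Finset.card_erase_of_mem hx]; omega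
    rw [Finset.sum_congr rfl this, Finset.sum_const, Finset.card_erase_of_mem hx, hV, nsmul_eq_mul]
    congr 1
    rw [show 2 * (m + 1) - 1 = 2 * m + 1 by omega]
    push_cast; ring

/-- Since exp(-cq) ≥ 1 - cq, it is enough that (1 - c + cq)(1 - cq) = 1 - c + c²q(1 - q) ≥ 1 - c. -/
theorem one_sub_mul_exp_le {c q : ℝ} (hc : c ≤ 1) (hq0 : 0 ≤ q) (hq1 : q ≤ 1) :
    (1 - c) * Real.exp (c * q) ≤ 1 - c + c * q := by
  have h1 : 1 - c * q ≤ Real.exp (-(c * q)) := by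
    have := Real.add_one_le_exp (-(c * q)); linarith
  have h0 : 0 ≤ 1 - c + c * q := by nlinarith
  have h2 : 1 - c ≤ (1 - c + c * q) * Real.exp (-(c * q)) := by
    have := mul_le_mul_of_nonneg_left h1 h0
    nlinarith [mul_nonneg (mul_nonneg (sq_nonneg c) hq0) (sub_nonneg.2 hq1)]
  calc (1 - c) * Real.exp (c * q)
      ≤ ((1 - c + c * q) * Real.exp (-(c * q))) * Real.exp (c * q) :=
        mul_le_mul_of_nonneg_right h2 (Real.exp_pos _).le
    _ = 1 - c + c * q := by rw [mul_assoc, ← Real.exp_add]; simp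

/-- The inductive step of `pairingSum_le`, with z = w ^ 2: among the 2m + 1 possible partners of an
element of A, a - 1 lie in A and 2m + 2 - a outside. -/
theorem exp_recursion_le {m a : ℕ} {z : ℝ} (hz : 0 ≤ z) (ha1 : 1 ≤ a) (ha : a ≤ 2 * m + 2) :
    ((a : ℝ) - 1) * (z * Real.exp ((z - 1) * (((a : ℝ) - 2) * ((a : ℝ) - 3) / (2 * (2 * m - 1)))))
      + (2 * m + 2 - a) * Real.exp ((z - 1) * (((a : ℝ) - 1) * ((a : ℝ) - 2) / (2 * (2 * m - 1))))
    ≤ (2 * m + 1) * Real.exp ((z - 1) * ((a : ℝ) * ((a : ℝ) - 1) / (2 * (2 * m + 1)))) := by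
  -- For m = 0 the denominator 2m - 1 is negative, but each term containing it has a zero numerator
  -- or a zero coefficient.
  rcases Nat.eq_zero_or_pos m with rfl | hm
  · obtain rfl | rfl : a = 1 ∨ a = 2 := by omega
    · norm_num
    · norm_num
      have := Real.add_one_le_exp (z - 1); linarith
  rcases Nat.eq_or_lt_of_le ha1 with rfl | ha2
  · norm_num
    linarith
  have hm' : (1 : ℝ) ≤ m := by exact_mod_cast hm
  have ha2' : (2 : ℝ) ≤ a := by exact_mod_cast ha2
  have ha' : (a : ℝ) ≤ 2 * m + 2 := by exact_mod_cast ha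
  have hd : (0 : ℝ) < 2 * m - 1 := by linarith
  have hD : (0 : ℝ) < 2 * m + 1 := by linarith
  -- If A is everything, the ratio (a - 2)/(2m - 1) exceeds 1 and `one_sub_mul_exp_le` does not
  -- apply; the claim is then just z ≤ exp(z - 1).
  by_cases hae : a = 2 * m + 2
  · have hae' : (a : ℝ) = 2 * m + 2 := by exact_mod_cast hae
    rw [hae']
    have e1 : ((2 * (m : ℝ) + 2 - 2) * (2 * (m : ℝ) + 2 - 3) / (2 * (2 * m - 1))) = m := by
      field_simp; ring
    have e2 : ((2 * (m : ℝ) + 2) * (2 * (m : ℝ) + 2 - 1) / (2 * (2 * m + 1))) = m + 1 := by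
      field_simp; ring
    rw [e1, e2, show (z - 1) * ((m : ℝ) + 1) = (z - 1) * m + (z - 1) by ring, Real.exp_add]
    have h1 : z ≤ Real.exp (z - 1) := by have := Real.add_one_le_exp (z - 1); linarith
    have := mul_le_mul_of_nonneg_left h1 (mul_pos hD (Real.exp_pos ((z - 1) * m))).le
    nlinarith
  have ha3 : (a : ℝ) ≤ 2 * m + 1 := by exact_mod_cast (by omega : a ≤ 2 * m + 1)
  -- Here p is the chance that the partner lies in A, and q the drop in the mean when that partner
  -- is deleted from A too. After division by (2m + 1)exp(E), the left side is at most 1 + (z -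
  -- 1)p(1 - q).
  set q : ℝ := (a - 2) / (2 * m - 1) with hq
  have hq0 : 0 ≤ q := div_nonneg (by linarith) hd.le
  have hq1 : q ≤ 1 := (div_le_one hd).2 (by linarith)
  set p : ℝ := (a - 1) / (2 * m + 1) with hp
  have hp0 : 0 ≤ p := div_nonneg (by linarith) hD.le
  set E : ℝ := (z - 1) * (((a : ℝ) - 1) * ((a : ℝ) - 2) / (2 * (2 * m - 1))) with hE
  have e1 : (z - 1) * (((a : ℝ) - 2) * ((a : ℝ) - 3) / (2 * (2 * m - 1))) = E + (1 - z) * q := by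
    rw [hE, hq]; field_simp; ring
  have e2 : (z - 1) * ((a : ℝ) * ((a : ℝ) - 1) / (2 * (2 * m + 1))) =
      E + (z - 1) * p * (1 - q) := by
    rw [hE, hq, hp]; field_simp; ring
  have e3 : (a : ℝ) - 1 = (2 * m + 1) * p := by rw [hp]; field_simp
  have e4 : (2 * m + 2 - a : ℝ) = (2 * m + 1) * (1 - p) := by rw [hp]; field_simp; ring
  rw [e1, e2, e4, Real.exp_add, Real.exp_add, e3]
  have h1 := one_sub_mul_exp_le (c := 1 - z) (by linarith) hq0 hq1
  have h2 := Real.add_one_le_exp ((z - 1) * p * (1 - q))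
  have h3 : p * (z * Real.exp ((1 - z) * q)) + (1 - p) ≤ Real.exp ((z - 1) * p * (1 - q)) := by
    have := mul_le_mul_of_nonneg_left h1 hp0
    nlinarith
  have := mul_le_mul_of_nonneg_left h3 (mul_pos hD (Real.exp_pos E)).le
  nlinarith

/-- The number of pairs inside a set has an exponential moment at most that of the Poisson
distribution with the same mean. -/
theorem pairingSum_le (w : ℝ) : ∀ (m : ℕ) {V A : Finset α}, V.card = 2 * m → A ⊆ V →
    pairingSum w V A ≤ (∏ i ∈ Finset.range m, (2 * (i : ℝ) + 1)) *
      Real.exp ((w ^ 2 - 1) * ((A.card : ℝ) * ((A.card : ℝ) - 1) / (2 * (2 * m - 1)))) := by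
  intro m
  induction m with
  | zero =>
    intro V A hV hA
    have hV0 : V = ∅ := by simpa using hV
    have hA0 : A = ∅ := by simpa [hV0] using hA
    have := card_pairingsOn 0 hV
    simp only [pairingSum, internalCount, hA0]
    simpa using this.le
  | succ m ih =>
    intro V A hV hA
    rcases A.eq_empty_or_nonempty with rfl | ⟨x, hx⟩
    · have := card_pairingsOn (m + 1) hV
      simp only [pairingSum, internalCount]
      simpa using this.le
    have hxV := hA hx
    set K : ℝ := ∏ i ∈ Finset.range m, (2 * (i : ℝ) + 1) with hK
    have hK0 : 0 ≤ K := Finset.prod_nonneg fun i _ => by positivity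
    have hApos : 1 ≤ A.card := Finset.card_pos.2 ⟨x, hx⟩
    have hAle : A.card ≤ 2 * m + 2 := by have := Finset.card_le_card hA; omega
    set a := A.card with ha
    rw [pairingSum_eq_sum w hxV hx]
    have hsplit : V.erase x = A.erase x ∪ (V \ A) := by
      ext h
      simp only [Finset.mem_erase, Finset.mem_union, Finset.mem_sdiff]
      constructor
      · rintro ⟨h1, h2⟩; tauto
      · rintro (⟨h1, h2⟩ | ⟨h1, h2⟩)
        · exact ⟨h1, hA h2⟩
        · exact ⟨fun hc => h2 (hc ▸ hx), h1⟩
    have hdisj : Disjoint (A.erase x) (V \ A) :=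
      Finset.disjoint_left.2 fun h h1 h2 =>
        (Finset.mem_sdiff.1 h2).2 (Finset.mem_of_mem_erase h1)
    have hcard : ∀ y ∈ V.erase x, ((V.erase x).erase y).card = 2 * m := by
      intro y hy
      rw [Finset.card_erase_of_mem hy, Finset.card_erase_of_mem hxV]; omega
    have hsub : ∀ y, (A.erase x).erase y ⊆ (V.erase x).erase y := fun y =>
      Finset.erase_subset_erase _ (Finset.erase_subset_erase _ hA)
    have b1 : ∀ y ∈ A.erase x, (if y ∈ A then w ^ 2 else 1) *
        pairingSum w ((V.erase x).erase y) ((A.erase x).erase y) ≤ w ^ 2 * (K *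
        Real.exp ((w ^ 2 - 1) * (((a : ℝ) - 2) * ((a : ℝ) - 3) / (2 * (2 * m - 1))))) := by
      intro y hy
      rw [if_pos (Finset.mem_of_mem_erase hy)]
      refine mul_le_mul_of_nonneg_left ?_ (sq_nonneg w)
      have h2 := ih (hcard y (by rw [hsplit]; exact Finset.mem_union_left _ hy)) (hsub y)
      have hc : (((A.erase x).erase y).card : ℝ) = a - 2 := by
        have h3 := Finset.card_erase_add_one hy
        have h4 := Finset.card_erase_add_one hx
        have : ((A.erase x).erase y).card + 2 = a := by omega
        rw [← this]; push_cast; ring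
      rw [hc] at h2
      rwa [show ((a : ℝ) - 2) * (a - 3) = (a - 2) * (a - 2 - 1) by ring]
    have b2 : ∀ y ∈ V \ A, (if y ∈ A then w ^ 2 else 1) *
        pairingSum w ((V.erase x).erase y) ((A.erase x).erase y) ≤ K *
        Real.exp ((w ^ 2 - 1) * (((a : ℝ) - 1) * ((a : ℝ) - 2) / (2 * (2 * m - 1)))) := by
      intro y hy
      have hyA := (Finset.mem_sdiff.1 hy).2
      rw [if_neg hyA, one_mul]
      have h2 := ih (hcard y (by rw [hsplit]; exact Finset.mem_union_right _ hy)) (hsub y)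
      have hc : (((A.erase x).erase y).card : ℝ) = a - 1 := by
        rw [Finset.erase_eq_of_notMem (fun h => hyA (Finset.mem_of_mem_erase h))]
        rw [Finset.card_erase_of_mem hx, Nat.cast_sub hApos]; simp [ha]
      rw [hc] at h2
      rwa [show ((a : ℝ) - 1) * (a - 2) = (a - 1) * (a - 1 - 1) by ring]
    rw [Finset.sum_congr hsplit fun _ _ => rfl, Finset.sum_union hdisj]
    refine (add_le_add (Finset.sum_le_card_nsmul _ _ _ b1)
      (Finset.sum_le_card_nsmul _ _ _ b2)).trans ?_
    have c1 : ((A.erase x).card : ℝ) = a - 1 := by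
      rw [Finset.card_erase_of_mem hx, Nat.cast_sub hApos]; simp [ha]
    have c2 : ((V \ A).card : ℝ) = 2 * m + 2 - a := by
      rw [Finset.card_sdiff_of_subset hA, hV, Nat.cast_sub (by omega)]; push_cast; ring
    rw [nsmul_eq_mul, nsmul_eq_mul, c1, c2, Finset.prod_range_succ]
    have := mul_le_mul_of_nonneg_left
      (exp_recursion_le (m := m) (a := a) (sq_nonneg w) hApos hAle) hK0
    have e : (2 * (((m + 1 : ℕ) : ℝ)) - 1) = 2 * m + 1 := by push_cast; ring
    rw [e]
    nlinarith

theorem pairingsOn_card_pos {m : ℕ} {V : Finset α} (hV : V.card = 2 * m) :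
    0 < (pairingsOn V).card := by
  have h := card_pairingsOn m hV
  have : (0 : ℝ) < ∏ i ∈ Finset.range m, (2 * (i : ℝ) + 1) :=
    Finset.prod_pos fun i _ => by positivity
  rw [← h] at this
  exact_mod_cast this

end Counting

/-! ### Edges inside percolation sets -/

section Components

variable {n d : ℕ}

/-- The half-edges emitted by the vertices of `S`. -/
def halfEdgesOf (d : ℕ) (S : Finset (Fin n)) : Finset (HalfEdge n d) := S ×ˢ Finset.univ

theorem mem_halfEdgesOf {S : Finset (Fin n)} {h : HalfEdge n d} :
    h ∈ halfEdgesOf d S ↔ h.1 ∈ S := by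
  simp [halfEdgesOf]

theorem card_halfEdgesOf (S : Finset (Fin n)) : (halfEdgesOf d S).card = S.card * d := by
  simp [halfEdgesOf]

theorem adj_induce_iff (p : Pairing n d) (S : Set (Fin n)) (x y : Fin n) :
    (p.toGraph.induce S).Adj x y ↔ (∃ h : HalfEdge n d, h.1 = x ∧ (p.1 h).1 = y) ∧ x ∈ S ∧ y ∈ S := by
  constructor
  · rintro ⟨e, ⟨h, rfl, h1, h2⟩, hx, hy⟩
    exact ⟨⟨h, h1, h2⟩, hx, hy⟩
  · rintro ⟨⟨h, h1, h2⟩, hx, hy⟩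
    exact ⟨_, ⟨h, rfl, h1, h2⟩, hx, hy⟩

/-- Deleting vertices only shrinks components. This permits both peeling off a component and
trimming a set to an exact size. -/
theorem isPercolationSet_mono {p : Pairing n d} {τ : ℝ} {S T : Set (Fin n)}
    (hS : p.toGraph.IsPercolationSet τ S) (hTS : T ⊆ S) : p.toGraph.IsPercolationSet τ T := by
  refine ⟨Set.subset_univ _, fun x hx => le_trans ?_ (hS.2 x (hTS hx))⟩
  have : (p.toGraph.induce T).componentOf x ⊆ (p.toGraph.induce S).componentOf x := by
    intro y hy
    refine Relation.ReflTransGen.mono (fun a b hab => ?_) _ _ hy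
    rw [adj_induce_iff] at hab ⊢
    exact ⟨hab.1, hTS hab.2.1, hTS hab.2.2⟩
  exact_mod_cast Set.ncard_le_ncard this (Set.toFinite _)

theorem internalCount_eq_add_of_closed (p : Pairing n d) {S C : Finset (Fin n)} (hCS : C ⊆ S)
    (hC : ∀ h : HalfEdge n d, h.1 ∈ C → (p.1 h).1 ∈ S → (p.1 h).1 ∈ C) :
    internalCount p.1 (halfEdgesOf d S) = internalCount p.1 (halfEdgesOf d C) +
      internalCount p.1 (halfEdgesOf d (S \ C)) := by
  unfold internalCount
  rw [← Finset.card_union_of_disjoint]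
  · congr 1
    ext h
    have h1 := hC h
    have h2 := hC (p.1 h)
    rw [p.2.1] at h2
    have h3 := @hCS h.1
    have h4 := @hCS (p.1 h).1
    simp only [Finset.mem_filter, Finset.mem_union, mem_halfEdgesOf, Finset.mem_sdiff]
    tauto
  · rw [Finset.disjoint_left]
    intro h
    simp only [Finset.mem_filter, mem_halfEdgesOf, Finset.mem_sdiff]
    tauto

theorem componentOf_induce_subset (p : Pairing n d) {S : Set (Fin n)} {x : Fin n} (hx : x ∈ S) :
    (p.toGraph.induce S).componentOf x ⊆ S := by
  intro y hy
  induction hy with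
  | refl => exact hx
  | tail _ h _ => exact ((adj_induce_iff _ _ _ _).1 h).2.2

/-- If all small sets are sparse, then so are the sets with small components. -/
theorem internalCount_le_of_isPercolationSet (p : Pairing n d) {τ : ℝ} {t : ℕ}
    (hsmall : ∀ U : Finset (Fin n), U.Nonempty → (U.card : ℝ) ≤ τ →
      internalCount p.1 (halfEdgesOf d U) ≤ t * U.card) :
    ∀ S : Finset (Fin n), p.toGraph.IsPercolationSet τ (S : Set (Fin n)) →
      internalCount p.1 (halfEdgesOf d S) ≤ t * S.card := by
  intro S
  induction S using Finset.strongInduction with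
  | H S ih =>
    intro hS
    rcases S.eq_empty_or_nonempty with rfl | ⟨x, hx⟩
    · simp [internalCount, halfEdgesOf]
    set G := p.toGraph.induce (S : Set (Fin n)) with hG
    set C : Finset (Fin n) := (Set.toFinite (G.componentOf x)).toFinset with hCdef
    have hmem : ∀ y, y ∈ C ↔ Relation.ReflTransGen G.Adj x y := by
      intro y; rw [hCdef, Set.Finite.mem_toFinset]; rfl
    have hCS : C ⊆ S := fun y hy =>
      Finset.mem_coe.1 (componentOf_induce_subset p (Finset.mem_coe.2 hx) ((hmem y).1 hy))
    have hxC : x ∈ C := (hmem x).2 Relation.ReflTransGen.refl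
    have hclosed : ∀ h : HalfEdge n d, h.1 ∈ C → (p.1 h).1 ∈ S → (p.1 h).1 ∈ C := by
      intro h h1 h2
      rw [hmem] at h1 ⊢
      exact h1.tail ((adj_induce_iff _ _ _ _).2 ⟨⟨h, rfl, rfl⟩, hCS ((hmem _).2 h1), h2⟩)
    have hτ : (C.card : ℝ) ≤ τ := by
      have := hS.2 x hx
      rwa [Set.ncard_eq_toFinset_card _ (Set.toFinite _)] at this
    have h1 := hsmall C ⟨x, hxC⟩ hτ
    -- Peel off the component C of x: no edge leaves it within S, so the edge counts of C and S \ C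
    -- add up.
    have hss : S \ C ⊂ S := Finset.sdiff_ssubset hCS ⟨x, hxC⟩
    have h2 := ih _ hss (isPercolationSet_mono hS (by exact_mod_cast hss.subset))
    rw [internalCount_eq_add_of_closed p hCS hclosed]
    have h3 := Finset.card_sdiff_add_card_eq_card hCS
    calc _ ≤ t * C.card + t * (S \ C).card := add_le_add h1 h2
      _ = t * S.card := by rw [← h3]; ring

end Components

/-! ### Chernoff bounds for the number of edges in a vertex set -/

section Tails

variable {n d : ℕ}

theorem sum_pairing_eq_pairingSum (w : ℝ) (A : Finset (HalfEdge n d)) :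
    ∑ p : Pairing n d, w ^ internalCount p.1 A = pairingSum w Finset.univ A := by
  unfold pairingSum
  rw [Finset.sum_subtype (pairingsOn (Finset.univ : Finset (HalfEdge n d)))
    (p := fun p => (∀ h, p (p h) = h) ∧ ∀ h, p h ≠ h)]
  intro p
  simp [mem_pairingsOn]

theorem card_pairing_eq : Fintype.card (Pairing n d) =
    (pairingsOn (Finset.univ : Finset (HalfEdge n d))).card := by
  have := sum_pairing_eq_pairingSum (n := n) (d := d) 1 ∅
  rw [pairingSum_one] at this
  simp only [one_pow, Finset.sum_const, nsmul_eq_mul, mul_one, Finset.card_univ] at this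
  exact_mod_cast this

theorem card_pairing_pos (hnd : Even (n * d)) : 0 < Fintype.card (Pairing n d) := by
  obtain ⟨m, hm⟩ := hnd
  rw [card_pairing_eq]
  exact pairingsOn_card_pos (m := m) (by simp; omega)

theorem sum_pairing_le (w : ℝ) (hnd : Even (n * d)) (A : Finset (HalfEdge n d)) :
    ∑ p : Pairing n d, w ^ internalCount p.1 A ≤ Fintype.card (Pairing n d) *
      Real.exp ((w ^ 2 - 1) * ((A.card : ℝ) * ((A.card : ℝ) - 1) / (2 * ((n : ℝ) * d - 1)))) := by
  obtain ⟨m, hm⟩ := hnd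
  have hcard : (Finset.univ : Finset (HalfEdge n d)).card = 2 * m := by simp; omega
  have := pairingSum_le w m hcard (Finset.subset_univ A)
  have e : (2 * (m : ℝ)) = n * d := by
    have : (n : ℝ) * d = m + m := by exact_mod_cast hm
    linarith
  rw [sum_pairing_eq_pairingSum, card_pairing_eq, card_pairingsOn m hcard, ← e]
  exact this

/-- Markov's inequality for w ^ `internalCount`; taking w ≥ 1 gives upper tails, and w ≤ 1 in the
next lemma gives lower tails. -/
theorem card_filter_le_internalCount {w : ℝ} (hw : 1 ≤ w) (hnd : Even (n * d))
    (A : Finset (HalfEdge n d)) (m : ℕ) :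
    ((Finset.univ.filter fun p : Pairing n d => m ≤ internalCount p.1 A).card : ℝ) * w ^ m ≤
      Fintype.card (Pairing n d) * Real.exp ((w ^ 2 - 1) *
        ((A.card : ℝ) * ((A.card : ℝ) - 1) / (2 * ((n : ℝ) * d - 1)))) := by
  refine le_trans ?_ (sum_pairing_le w hnd A)
  calc _ = ∑ p : Pairing n d with m ≤ internalCount p.1 A, w ^ m := by
        rw [Finset.sum_const, nsmul_eq_mul]
    _ ≤ ∑ p : Pairing n d with m ≤ internalCount p.1 A, w ^ internalCount p.1 A :=
        Finset.sum_le_sum fun p hp => pow_le_pow_right₀ hw (Finset.mem_filter.1 hp).2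
    _ ≤ _ := Finset.sum_le_sum_of_subset_of_nonneg (Finset.subset_univ _) fun p _ _ =>
        pow_nonneg (by linarith) _

theorem card_filter_internalCount_le {w : ℝ} (hw0 : 0 ≤ w) (hw : w ≤ 1) (hnd : Even (n * d))
    (A : Finset (HalfEdge n d)) (m : ℕ) :
    ((Finset.univ.filter fun p : Pairing n d => internalCount p.1 A ≤ m).card : ℝ) * w ^ m ≤
      Fintype.card (Pairing n d) * Real.exp ((w ^ 2 - 1) *
        ((A.card : ℝ) * ((A.card : ℝ) - 1) / (2 * ((n : ℝ) * d - 1)))) := by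
  refine le_trans ?_ (sum_pairing_le w hnd A)
  calc _ = ∑ p : Pairing n d with internalCount p.1 A ≤ m, w ^ m := by
        rw [Finset.sum_const, nsmul_eq_mul]
    _ ≤ ∑ p : Pairing n d with internalCount p.1 A ≤ m, w ^ internalCount p.1 A :=
        Finset.sum_le_sum fun p hp => pow_le_pow_of_le_one hw0 hw (Finset.mem_filter.1 hp).2
    _ ≤ _ := Finset.sum_le_sum_of_subset_of_nonneg (Finset.subset_univ _) fun p _ _ =>
        pow_nonneg (by linarith) _

/-- Upper tail: `s` vertices span at least `m` edges. -/
theorem card_dense_le (hnd : Even (n * d)) (hn : 0 < n) (hd : 0 < d) (U : Finset (Fin n)) {m : ℕ}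
    (hm : 0 < m) (hU : U.Nonempty) (hm2 : (d : ℝ) * (U.card : ℝ) ^ 2 ≤ 2 * n * m) :
    ((Finset.univ.filter fun p : Pairing n d =>
        2 * m ≤ internalCount p.1 (halfEdgesOf d U)).card : ℝ) ≤
      Fintype.card (Pairing n d) *
        (Real.exp 1 * (d * (U.card : ℝ) ^ 2 / (2 * n * m))) ^ m := by
  have hs : (0 : ℝ) < U.card := by exact_mod_cast Finset.card_pos.2 hU
  have hsn : (U.card : ℝ) ≤ n := by
    exact_mod_cast (Finset.card_le_univ U).trans_eq (Fintype.card_fin n)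
  have hn' : (0 : ℝ) < n := by exact_mod_cast hn
  have hd' : (1 : ℝ) ≤ d := by exact_mod_cast hd
  have hm' : (0 : ℝ) < m := by exact_mod_cast hm
  set s : ℝ := (U.card : ℝ) with hsdef
  set y : ℝ := d * s ^ 2 / (2 * n * m) with hy
  have hy0 : 0 < y := by positivity
  have hy1 : y ≤ 1 := (div_le_one (by positivity)).2 hm2
  -- The usual Chernoff choice: y * m = ds²/(2n) bounds the mean from above, and w ^ 2 is the ratio
  -- of m to it.
  set w : ℝ := Real.sqrt (1 / y) with hwdef
  have hw2 : w ^ 2 = 1 / y := Real.sq_sqrt (by positivity)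
  have hw1 : 1 ≤ w := by
    rw [hwdef, Real.one_le_sqrt]; exact (one_le_div hy0).2 hy1
  have h := card_filter_le_internalCount hw1 hnd (halfEdgesOf d U) (2 * m)
  rw [pow_mul, hw2, card_halfEdgesOf, Nat.cast_mul, ← hsdef] at h
  have hnd2 : (2 : ℝ) ≤ n * d := by
    obtain ⟨k, hk⟩ := hnd
    have : 0 < n * d := Nat.mul_pos hn hd
    have : 2 ≤ n * d := by omega
    exact_mod_cast this
  have hmu : s * d * (s * d - 1) / (2 * ((n : ℝ) * d - 1)) ≤ y * m := by
    have : y * m = d * s ^ 2 / (2 * n) := by rw [hy]; field_simp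
    rw [this, div_le_div_iff₀ (by linarith) (by positivity)]
    have h1 : 0 ≤ s * d * (n - s) := by
      have := sub_nonneg.2 hsn; positivity
    nlinarith
  have hexp : Real.exp ((1 / y - 1) * (s * d * (s * d - 1) / (2 * ((n : ℝ) * d - 1)))) ≤
      Real.exp m := by
    apply Real.exp_le_exp.2
    have h0 : 0 ≤ 1 / y - 1 := sub_nonneg.2 ((one_le_div hy0).2 hy1)
    calc _ ≤ (1 / y - 1) * (y * m) := mul_le_mul_of_nonneg_left hmu h0
      _ = m - y * m := by field_simp
      _ ≤ m := by nlinarith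
  have h2 := h.trans (mul_le_mul_of_nonneg_left hexp (Nat.cast_nonneg _))
  rw [mul_pow, ← Real.exp_nat_mul, mul_one, ← mul_assoc]
  rw [one_div, inv_pow, ← div_eq_mul_inv, div_le_iff₀ (by positivity)] at h2
  exact h2

/-- Lower tail: `k` vertices span at most `m` edges. -/
theorem card_sparse_le (hnd : Even (n * d)) (hn : 0 < n) (hd : 0 < d) (S : Finset (Fin n)) (m : ℕ)
    (hS : S.Nonempty) {η : ℝ} (h0 : 0 < η) (h1 : η ≤ 1) :
    ((Finset.univ.filter fun p : Pairing n d =>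
        internalCount p.1 (halfEdgesOf d S) ≤ 2 * m).card : ℝ) ≤
      Fintype.card (Pairing n d) * (Real.exp (m * Real.log (1 / η)) *
        Real.exp (1 / 2 - (1 - η) * (d * (S.card : ℝ) ^ 2 / (2 * n)))) := by
  have hs : (1 : ℝ) ≤ S.card := by exact_mod_cast Finset.card_pos.2 hS
  have hsn : (S.card : ℝ) ≤ n := by
    exact_mod_cast (Finset.card_le_univ S).trans_eq (Fintype.card_fin n)
  have hn' : (0 : ℝ) < n := by exact_mod_cast hn
  have hd' : (1 : ℝ) ≤ d := by exact_mod_cast hd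
  set s : ℝ := (S.card : ℝ) with hsdef
  have hw2 : (Real.sqrt η) ^ 2 = η := Real.sq_sqrt h0.le
  have h := card_filter_internalCount_le (Real.sqrt_nonneg η) (Real.sqrt_le_one.2 h1) hnd
    (halfEdgesOf d S) (2 * m)
  rw [pow_mul, hw2, card_halfEdgesOf, Nat.cast_mul, ← hsdef] at h
  have hnd2 : (2 : ℝ) ≤ n * d := by
    obtain ⟨k, hk⟩ := hnd
    have : 0 < n * d := Nat.mul_pos hn hd
    have : 2 ≤ n * d := by omega
    exact_mod_cast this
  -- The exact mean may fall below ds²/(2n), but by at most s/(2n) ≤ 1/2.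
  have hmu : d * s ^ 2 / (2 * n) - 1 / 2 ≤ s * d * (s * d - 1) / (2 * ((n : ℝ) * d - 1)) := by
    have hsd : 0 ≤ s * d * (s * d - 1) := mul_nonneg (by positivity) (by nlinarith)
    have : s * d * (s * d - 1) / (2 * ((n : ℝ) * d)) ≤
        s * d * (s * d - 1) / (2 * ((n : ℝ) * d - 1)) :=
      div_le_div_of_nonneg_left hsd (by linarith) (by linarith)
    refine le_trans ?_ this
    have e : s * d * (s * d - 1) / (2 * ((n : ℝ) * d)) = d * s ^ 2 / (2 * n) - s / (2 * n) := by
      field_simp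
    rw [e]
    have : s / (2 * n) ≤ 1 / 2 := by
      rw [div_le_div_iff₀ (by positivity) (by norm_num)]; linarith
    linarith
  have hexp : Real.exp ((η - 1) * (s * d * (s * d - 1) / (2 * ((n : ℝ) * d - 1)))) ≤
      Real.exp (1 / 2 - (1 - η) * (d * s ^ 2 / (2 * n))) := by
    apply Real.exp_le_exp.2
    have := mul_le_mul_of_nonneg_left hmu (sub_nonneg.2 h1)
    nlinarith
  have h2 := h.trans (mul_le_mul_of_nonneg_left hexp (Nat.cast_nonneg _))
  have e : Real.exp (m * Real.log (1 / η)) = (η ^ m)⁻¹ := by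
    rw [Real.exp_nat_mul, Real.exp_log (by positivity), one_div, inv_pow]
  rw [← le_div_iff₀ (by positivity)] at h2
  rw [e]
  refine h2.trans_eq ?_
  rw [div_eq_mul_inv]; ring

end Tails

/-! ### Union bounds over vertex sets -/

theorem choose_le_exp_mul_div_pow (n : ℕ) {k : ℕ} (hk : 0 < k) :
    (n.choose k : ℝ) ≤ (Real.exp 1 * n / k) ^ k := by
  have hk' : (0 : ℝ) < k := by exact_mod_cast hk
  have h1 : (n.choose k : ℝ) ≤ (n : ℝ) ^ k / k.factorial := Nat.choose_le_pow_div k n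
  have h2 : (k : ℝ) ^ k / k.factorial ≤ Real.exp k := Real.pow_div_factorial_le_exp k hk'.le k
  have hf : (0 : ℝ) < k.factorial := by exact_mod_cast k.factorial_pos
  refine h1.trans ?_
  rw [div_pow, mul_pow, ← Real.exp_nat_mul, mul_one, div_le_div_iff₀ hf (by positivity)]
  rw [div_le_iff₀ hf] at h2
  have := mul_le_mul_of_nonneg_left h2 (pow_nonneg (Nat.cast_nonneg (α := ℝ) n) k)
  linarith

theorem card_filter_exists_le {ι κ : Type*} [Fintype ι] (F : Finset κ)
    (Q : ι → κ → Prop) [∀ U, DecidablePred fun p => Q p U]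
    [DecidablePred fun p => ∃ U ∈ F, Q p U] :
    (Finset.univ.filter fun p => ∃ U ∈ F, Q p U).card ≤
      ∑ U ∈ F, (Finset.univ.filter fun p => Q p U).card := by
  classical
  refine le_trans (Finset.card_le_card ?_) Finset.card_biUnion_le
  intro p
  simp

theorem exp_one_sq_lt_eight : Real.exp 1 ^ 2 < 8 := by
  have := Real.exp_one_lt_d9
  have h0 := Real.exp_pos 1
  nlinarith

/-- The left side is at most x^s with x = (en/s)y^t, which is e²d/(2t) · y^(t-1). The assumption on
Y and e² < 8 ≤ t give x ≤ 1/2. One factor x is bounded instead by a multiple of y, which is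
proportional to s/n: this supplies the decay in n, and the other s - 1 factors make the sum over s
converge. -/
theorem choose_mul_dense_le {n d t s : ℕ} {Y : ℝ} (hn : 0 < n) (hd : 0 < d) (ht : 8 ≤ t)
    (hs : 0 < s) (hY1 : Y ≤ 1) (hYt : Y ^ (t - 1) ≤ 1 / d)
    (hsY : Real.exp 1 * (d * s / (2 * n * t)) ≤ Y) :
    (n.choose s : ℝ) * (Real.exp 1 * (d * (s : ℝ) ^ 2 / (2 * n * (t * s : ℕ)))) ^ (t * s) ≤
      Real.exp 1 ^ 3 * d ^ 2 / (2 * t ^ 2) / n * (s * (1 / 2) ^ s) := by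
  have hn' : (0 : ℝ) < n := by exact_mod_cast hn
  have hd' : (0 : ℝ) < d := by exact_mod_cast hd
  have hs' : (0 : ℝ) < s := by exact_mod_cast hs
  have ht' : (8 : ℝ) ≤ t := by exact_mod_cast ht
  have he := Real.exp_pos 1
  set e := Real.exp 1 with hedef
  set y : ℝ := e * (d * s / (2 * n * t)) with hy
  have hy0 : 0 < y := by positivity
  have hy1 : y ≤ 1 := hsY.trans hY1
  have e1 : e * (d * (s : ℝ) ^ 2 / (2 * n * (t * s : ℕ))) = y := by
    rw [hy]; push_cast; field_simp
  set x : ℝ := e * n / s * y ^ t with hx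
  have hxe : x = e ^ 2 * d / (2 * t) * y ^ (t - 1) := by
    have : y ^ t = y ^ (t - 1) * y := by rw [← pow_succ]; congr 1; omega
    rw [hx, this]
    field_simp
    rw [hy]; field_simp
  have hx0 : 0 ≤ x := by positivity
  have hxhalf : x ≤ 1 / 2 := by
    have h1 : y ^ (t - 1) ≤ 1 / d := (pow_le_pow_left₀ hy0.le hsY _).trans hYt
    calc x ≤ e ^ 2 * d / (2 * t) * (1 / d) := by
          rw [hxe]; exact mul_le_mul_of_nonneg_left h1 (by positivity)
      _ = e ^ 2 / (2 * t) := by field_simp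
      _ ≤ 1 / 2 := by
          rw [div_le_div_iff₀ (by positivity) (by norm_num)]
          have := exp_one_sq_lt_eight
          linarith
  have hxn : x ≤ e ^ 2 * d / (2 * t) * y := by
    rw [hxe]
    refine mul_le_mul_of_nonneg_left ?_ (by positivity)
    exact pow_le_of_le_one hy0.le hy1 (by omega)
  have hc := choose_le_exp_mul_div_pow n hs
  rw [e1, pow_mul]
  calc (n.choose s : ℝ) * (y ^ t) ^ s ≤ (e * n / s) ^ s * (y ^ t) ^ s :=
        mul_le_mul_of_nonneg_right hc (by positivity)
    _ = x * x ^ (s - 1) := by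
        rw [← mul_pow, ← hx, ← pow_succ']; congr 1; omega
    _ ≤ (e ^ 2 * d / (2 * t) * y) * (1 / 2) ^ (s - 1) :=
        mul_le_mul hxn (pow_le_pow_left₀ hx0 hxhalf _) (by positivity) (by positivity)
    _ = e ^ 3 * d ^ 2 / (2 * t ^ 2) / n * (s * (1 / 2) ^ s) := by
        have : ((1 : ℝ) / 2) ^ s = (1 / 2) ^ (s - 1) * (1 / 2) := by
          rw [← pow_succ]; congr 1; omega
        rw [this, hy]; field_simp

open Classical in
/-- With high probability, all small sets of vertices are sparse. -/
theorem exists_card_dense_le {d t : ℕ} {σ : ℝ} (hd : 0 < d) (ht : 8 ≤ t)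
    (hY1 : Real.exp 1 * (d * σ / (2 * t)) ≤ 1)
    (hYt : (Real.exp 1 * (d * σ / (2 * t))) ^ (t - 1) ≤ 1 / d) :
    ∃ C : ℝ, ∀ n : ℕ, 0 < n → Even (n * d) →
      ((Finset.univ.filter fun p : Pairing n d => ∃ U : Finset (Fin n), U.Nonempty ∧
        (U.card : ℝ) ≤ σ * n ∧ 2 * (t * U.card) ≤ internalCount p.1 (halfEdgesOf d U)).card : ℝ) ≤
      Fintype.card (Pairing n d) * (C / n) := by
  have hsum : Summable fun s : ℕ => (s : ℝ) * (1 / 2) ^ s := by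
    simpa using summable_pow_mul_geometric_of_norm_lt_one (R := ℝ) 1 (r := 1 / 2) (by norm_num)
  set D : ℝ := Real.exp 1 ^ 3 * d ^ 2 / (2 * t ^ 2) with hD
  have hD0 : 0 ≤ D := by positivity
  refine ⟨D * ∑' s : ℕ, (s : ℝ) * (1 / 2) ^ s, fun n hn hnd => ?_⟩
  have hn' : (0 : ℝ) < n := by exact_mod_cast hn
  have ht' : (8 : ℝ) ≤ t := by exact_mod_cast ht
  set K : ℝ := (Fintype.card (Pairing n d) : ℝ) with hK
  set F : Finset ℕ := (Finset.range (n + 1)).filter fun s => 0 < s ∧ (s : ℝ) ≤ σ * n with hF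
  set Q : Pairing n d → Finset (Fin n) → Prop := fun p U =>
    2 * (t * U.card) ≤ internalCount p.1 (halfEdgesOf d U) with hQ
  have hsY : ∀ s ∈ F, Real.exp 1 * (d * s / (2 * n * t)) ≤ Real.exp 1 * (d * σ / (2 * t)) := by
    intro s hs
    have h := (Finset.mem_filter.1 hs).2.2
    refine mul_le_mul_of_nonneg_left ?_ (Real.exp_pos 1).le
    rw [div_le_div_iff₀ (by positivity) (by positivity)]
    have := mul_le_mul_of_nonneg_left h (show (0 : ℝ) ≤ d * (2 * t) by positivity)
    nlinarith
  have hterm : ∀ s ∈ F, ∀ U ∈ Finset.powersetCard s (Finset.univ : Finset (Fin n)),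
      ((Finset.univ.filter fun p => Q p U).card : ℝ) ≤
        K * (Real.exp 1 * (d * (s : ℝ) ^ 2 / (2 * n * (t * s : ℕ)))) ^ (t * s) := by
    intro s hs U hU
    obtain ⟨-, rfl⟩ := Finset.mem_powersetCard.1 hU
    have hpos := (Finset.mem_filter.1 hs).2.1
    have hs' : (0 : ℝ) < U.card := by exact_mod_cast hpos
    refine card_dense_le hnd hn hd U (m := t * U.card) (by positivity)
      (Finset.card_pos.1 hpos) ?_
    have h1 := (hsY _ hs).trans hY1
    have h2 : (d : ℝ) * U.card / (2 * n * t) ≤ 1 := by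
      refine le_trans ?_ h1
      exact le_mul_of_one_le_left (by positivity) (Real.one_le_exp (by norm_num))
    rw [div_le_one (by positivity)] at h2
    push_cast
    nlinarith
  calc _ ≤ ((Finset.univ.filter fun p => ∃ s ∈ F, ∃ U ∈ Finset.powersetCard s
        (Finset.univ : Finset (Fin n)), Q p U).card : ℝ) := by
        refine Nat.cast_le.2 (Finset.card_le_card ?_)
        intro p hp
        obtain ⟨U, hU, h1, h2⟩ := (Finset.mem_filter.1 hp).2
        refine Finset.mem_filter.2 ⟨Finset.mem_univ _, U.card, ?_, U, ?_, h2⟩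
        · refine Finset.mem_filter.2 ⟨?_, Finset.card_pos.2 hU, h1⟩
          rw [Finset.mem_range, Nat.lt_succ_iff]
          exact (Finset.card_le_univ U).trans_eq (Fintype.card_fin n)
        · exact Finset.mem_powersetCard.2 ⟨Finset.subset_univ _, rfl⟩
    _ ≤ ∑ s ∈ F, ((Finset.univ.filter fun p => ∃ U ∈ Finset.powersetCard s
        (Finset.univ : Finset (Fin n)), Q p U).card : ℝ) := by
        exact_mod_cast card_filter_exists_le F fun p s => ∃ U ∈ Finset.powersetCard s
          (Finset.univ : Finset (Fin n)), Q p U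
    _ ≤ ∑ s ∈ F, ∑ U ∈ Finset.powersetCard s (Finset.univ : Finset (Fin n)),
        ((Finset.univ.filter fun p => Q p U).card : ℝ) := by
        refine Finset.sum_le_sum fun s _ => ?_
        exact_mod_cast card_filter_exists_le _ Q
    _ ≤ ∑ s ∈ F, K * (D / n * (s * (1 / 2) ^ s)) := by
        refine Finset.sum_le_sum fun s hs => ?_
        refine (Finset.sum_le_card_nsmul _ _ _ (hterm s hs)).trans ?_
        rw [Finset.card_powersetCard, Finset.card_univ, Fintype.card_fin, nsmul_eq_mul,
          mul_left_comm]
        exact mul_le_mul_of_nonneg_left (choose_mul_dense_le hn hd ht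
          (Finset.mem_filter.1 hs).2.1 hY1 hYt (hsY s hs)) (Nat.cast_nonneg _)
    _ = K * (D / n * ∑ s ∈ F, (s : ℝ) * (1 / 2) ^ s) := by
        rw [Finset.mul_sum, Finset.mul_sum]
    _ ≤ K * (D / n * ∑' s : ℕ, (s : ℝ) * (1 / 2) ^ s) := by
        refine mul_le_mul_of_nonneg_left (mul_le_mul_of_nonneg_left ?_ (by positivity))
          (Nat.cast_nonneg _)
        exact hsum.sum_le_tsum _ fun i _ => by positivity
    _ = _ := by ring

open Classical in
/-- No set of `k` vertices is sparse, with high probability. -/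
theorem card_sparse_exists_le {n d t k : ℕ} {ε η δ : ℝ} (hnd : Even (n * d)) (hn : 0 < n)
    (hd : 0 < d) (hk : 0 < k) (hη0 : 0 < η) (hη1 : η ≤ 1) (hL : 2 ≤ Real.log d)
    (hε : 0 < ε) (ht : (t : ℝ) ≤ δ * Real.log d) (hδ : δ * Real.log (1 / η) ≤ ε / 8)
    (hη : 1 + ε / 4 ≤ (1 - η) * (1 + ε / 2))
    (hkn : (2 + ε) * (Real.log d / d) * n ≤ k) :
    ((Finset.univ.filter fun p : Pairing n d => ∃ S : Finset (Fin n), S.card = k ∧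
        internalCount p.1 (halfEdgesOf d S) ≤ 2 * (t * k)).card : ℝ) ≤
      Fintype.card (Pairing n d) * Real.exp (1 / 2 - k * (Real.log d * (ε / 8))) := by
  set L := Real.log d with hLdef
  have hn' : (0 : ℝ) < n := by exact_mod_cast hn
  have hd' : (0 : ℝ) < d := by exact_mod_cast hd
  have hk' : (0 : ℝ) < k := by exact_mod_cast hk
  set K : ℝ := (Fintype.card (Pairing n d) : ℝ) with hK
  set Q : Pairing n d → Finset (Fin n) → Prop := fun p S =>
    internalCount p.1 (halfEdgesOf d S) ≤ 2 * (t * k) with hQ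
  have hlog0 : 0 ≤ Real.log (1 / η) := Real.log_nonneg ((one_le_div hη0).2 hη1)
  have hdk : (1 + ε / 2) * L * k ≤ d * (k : ℝ) ^ 2 / (2 * n) := by
    rw [le_div_iff₀ (by positivity)]
    have h1 : (2 + ε) * L * n ≤ k * d := by
      have := mul_le_mul_of_nonneg_right hkn hd'.le
      have e : (2 + ε) * (L / d) * n * d = (2 + ε) * L * n := by field_simp
      linarith
    nlinarith [mul_le_mul_of_nonneg_left h1 hk'.le]
  -- As k ≥ (2+ε)Ln/d and e ≤ (2+ε)L, the base en/k is at most d.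
  have hchoose : (n.choose k : ℝ) ≤ Real.exp (k * L) := by
    refine (choose_le_exp_mul_div_pow n hk).trans ?_
    rw [Real.exp_nat_mul, hLdef, Real.exp_log hd']
    refine pow_le_pow_left₀ (by positivity) ?_ _
    rw [div_le_iff₀ hk']
    have h1 : (2 + ε) * L * n ≤ k * d := by
      have := mul_le_mul_of_nonneg_right hkn hd'.le
      have e : (2 + ε) * (L / d) * n * d = (2 + ε) * L * n := by field_simp
      linarith
    have h2 : Real.exp 1 ≤ (2 + ε) * L := by
      have := Real.exp_one_lt_d9
      nlinarith
    have := mul_le_mul_of_nonneg_right h2 hn'.le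
    linarith
  -- In units of kL: the mean yields at least 1 + ε/4, the choice of the set costs 1 and the
  -- threshold tk costs at most ε/8, so ε/8 remains.
  have hexp : (t * k : ℕ) * Real.log (1 / η) + (1 / 2 - (1 - η) * (d * (k : ℝ) ^ 2 / (2 * n))) +
      k * L ≤ 1 / 2 - k * (L * (ε / 8)) := by
    have h1 : (t : ℝ) * Real.log (1 / η) ≤ L * (ε / 8) := by
      have := mul_le_mul_of_nonneg_right ht hlog0
      nlinarith
    have h2 := mul_le_mul_of_nonneg_left hdk (sub_nonneg.2 hη1)
    have h3 : (1 + ε / 4) * (L * k) ≤ (1 - η) * (1 + ε / 2) * (L * k) :=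
      mul_le_mul_of_nonneg_right hη (by positivity)
    have h4 := mul_le_mul_of_nonneg_left h1 hk'.le
    push_cast
    nlinarith
  calc _ ≤ ((Finset.univ.filter fun p => ∃ S ∈ Finset.powersetCard k
        (Finset.univ : Finset (Fin n)), Q p S).card : ℝ) := by
        refine Nat.cast_le.2 (Finset.card_le_card ?_)
        intro p hp
        obtain ⟨S, hS, h1⟩ := (Finset.mem_filter.1 hp).2
        exact Finset.mem_filter.2 ⟨Finset.mem_univ _, S,
          Finset.mem_powersetCard.2 ⟨Finset.subset_univ _, hS⟩, h1⟩
    _ ≤ ∑ S ∈ Finset.powersetCard k (Finset.univ : Finset (Fin n)),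
        ((Finset.univ.filter fun p => Q p S).card : ℝ) := by
        exact_mod_cast card_filter_exists_le _ Q
    _ ≤ n.choose k * (K * (Real.exp ((t * k : ℕ) * Real.log (1 / η)) *
        Real.exp (1 / 2 - (1 - η) * (d * (k : ℝ) ^ 2 / (2 * n))))) := by
        refine (Finset.sum_le_card_nsmul _ _ (K * (Real.exp ((t * k : ℕ) * Real.log (1 / η)) *
          Real.exp (1 / 2 - (1 - η) * (d * (k : ℝ) ^ 2 / (2 * n))))) fun S hS => ?_).trans_eq ?_
        · obtain ⟨-, hS⟩ := Finset.mem_powersetCard.1 hS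
          have := card_sparse_le hnd hn hd S (t * k) (Finset.card_pos.1 (hS ▸ hk)) hη0 hη1
          rw [hS] at this
          exact this
        · rw [Finset.card_powersetCard, Finset.card_univ, Fintype.card_fin, nsmul_eq_mul]
    _ ≤ Real.exp (k * L) * (K * (Real.exp ((t * k : ℕ) * Real.log (1 / η)) *
        Real.exp (1 / 2 - (1 - η) * (d * (k : ℝ) ^ 2 / (2 * n))))) :=
        mul_le_mul_of_nonneg_right hchoose (by positivity)
    _ = K * Real.exp ((t * k : ℕ) * Real.log (1 / η) +
        (1 / 2 - (1 - η) * (d * (k : ℝ) ^ 2 / (2 * n))) + k * L) := by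
        rw [Real.exp_add, Real.exp_add]; ring
    _ ≤ _ := mul_le_mul_of_nonneg_left (Real.exp_le_exp.2 hexp) (Nat.cast_nonneg _)

/-! ### Passage to probabilities and choice of parameters -/

theorem configProb_le_one (n d : ℕ) (P : Graph (Fin n) (Sym2 (HalfEdge n d)) → Prop) :
    configProb n d P ≤ 1 := by
  unfold configProb
  refine div_le_one_of_le₀ ?_ (Nat.cast_nonneg _)
  exact_mod_cast Set.ncard_le_card _

theorem one_sub_le_configProb {n d : ℕ} (hnd : Even (n * d))
    {P : Graph (Fin n) (Sym2 (HalfEdge n d)) → Prop}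
    [DecidablePred fun p : Pairing n d => P p.toGraph] {b : ℝ}
    (h : ((Finset.univ.filter fun p : Pairing n d => ¬ P p.toGraph).card : ℝ) ≤
      Fintype.card (Pairing n d) * b) : 1 - b ≤ configProb n d P := by
  have hpos : (0 : ℝ) < Fintype.card (Pairing n d) := by exact_mod_cast card_pairing_pos hnd
  unfold configProb
  rw [Nat.card_eq_fintype_card, le_div_iff₀ hpos, Set.ncard_eq_toFinset_card']
  have hc := Finset.card_filter_add_card_filter_not (s := Finset.univ)
    (fun p : Pairing n d => P p.toGraph)
  rw [Finset.card_univ] at hc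
  have hc' : ((Finset.univ.filter fun p : Pairing n d => P p.toGraph).card : ℝ) +
    ((Finset.univ.filter fun p : Pairing n d => ¬ P p.toGraph).card : ℝ) =
      Fintype.card (Pairing n d) := by exact_mod_cast hc
  rw [Set.toFinset_ofPred]
  linarith

/-- A percolation set of size more than `B` forces a small dense set, or a sparse set of
size `⌊B⌋₊ + 1`. -/
theorem exists_dense_or_sparse {n d t : ℕ} (p : Pairing n d) {τ B : ℝ} (hB : 0 ≤ B)
    {S : Set (Fin n)} (hS : p.toGraph.IsPercolationSet τ S) (hSB : B < S.ncard) :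
    (∃ U : Finset (Fin n), U.Nonempty ∧ (U.card : ℝ) ≤ τ ∧
      2 * (t * U.card) ≤ internalCount p.1 (halfEdgesOf d U)) ∨
    ∃ T : Finset (Fin n), T.card = ⌊B⌋₊ + 1 ∧
      internalCount p.1 (halfEdgesOf d T) ≤ 2 * (t * (⌊B⌋₊ + 1)) := by
  by_cases hU : ∃ U : Finset (Fin n), U.Nonempty ∧ (U.card : ℝ) ≤ τ ∧
      2 * (t * U.card) ≤ internalCount p.1 (halfEdgesOf d U)
  · exact Or.inl hU
  right
  push Not at hU
  rw [Set.ncard_eq_toFinset_card S (Set.toFinite S)] at hSB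
  -- Trimming to one exact size lets the sparse union bound run over a single k.
  obtain ⟨T, hTS, hT⟩ := Finset.exists_subset_card_eq
    (Nat.succ_le_of_lt ((Nat.floor_lt hB).2 hSB))
  refine ⟨T, hT, ?_⟩
  have hperc : p.toGraph.IsPercolationSet τ (T : Set (Fin n)) :=
    isPercolationSet_mono hS fun x hx => (Set.Finite.mem_toFinset _).1 (hTS (Finset.mem_coe.1 hx))
  -- `internalCount` counts half-edges, twice the number of edges, hence 2 * t.
  have := internalCount_le_of_isPercolationSet p (t := 2 * t)
    (fun U h1 h2 => by have := hU U h1 h2; nlinarith) T hperc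
  rw [hT] at this
  exact this.trans_eq (by rw [mul_assoc])

/-- The two bad events have probabilities at most C/n and exp(1/2 - cn), with C and c > 0
independent of n. -/
theorem configWHP_of_parameters {d t : ℕ} {σ ε η δ : ℝ} (hd : 0 < d) (ht : 8 ≤ t)
    (hY1 : Real.exp 1 * (d * σ / (2 * t)) ≤ 1)
    (hYt : (Real.exp 1 * (d * σ / (2 * t))) ^ (t - 1) ≤ 1 / d)
    (hη0 : 0 < η) (hη1 : η ≤ 1) (hL : 2 ≤ Real.log d)
    (hε : 0 < ε) (htδ : (t : ℝ) ≤ δ * Real.log d) (hδ : δ * Real.log (1 / η) ≤ ε / 8)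
    (hη : 1 + ε / 4 ≤ (1 - η) * (1 + ε / 2)) :
    ConfigWHP d (fun n G => ∀ S : Set (Fin n), G.IsPercolationSet (σ * n) S →
      (S.ncard : ℝ) ≤ (2 + ε) * (Real.log (d : ℝ) / (d : ℝ)) * (n : ℝ)) := by
  classical
  obtain ⟨C, hC⟩ := exists_card_dense_le hd ht hY1 hYt
  set β : ℝ := (2 + ε) * (Real.log (d : ℝ) / (d : ℝ)) with hβ
  have hd' : (0 : ℝ) < d := by exact_mod_cast hd
  have hβ0 : 0 < β := by positivity
  set c : ℝ := β * (Real.log d * (ε / 8)) with hc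
  have hc0 : 0 < c := by positivity
  have hlim : Tendsto (fun n : ℕ => 1 - (C / (n : ℝ) + Real.exp (1 / 2 - c * n))) atTop (𝓝 1) := by
    have h1 : Tendsto (fun n : ℕ => C / (n : ℝ)) atTop (𝓝 0) :=
      tendsto_const_div_atTop_nhds_zero_nat C
    have h2 : Tendsto (fun n : ℕ => Real.exp (1 / 2 - c * n)) atTop (𝓝 0) := by
      refine Real.tendsto_exp_atBot.comp ?_
      refine tendsto_atBot_add_const_left atTop (1 / 2) ?_
      exact tendsto_neg_atTop_atBot.comp (tendsto_natCast_atTop_atTop.const_mul_atTop hc0)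
    simpa using (tendsto_const_nhds (x := (1 : ℝ))).sub (h1.add h2)
  refine tendsto_of_tendsto_of_tendsto_of_le_of_le' (hlim.mono_left inf_le_left)
    tendsto_const_nhds ?_ (Eventually.of_forall fun n => configProb_le_one _ _ _)
  have hev : ∀ᶠ n : ℕ in atTop ⊓ 𝓟 {n : ℕ | Even (n * d)}, 0 < n ∧ Even (n * d) :=
    ((eventually_gt_atTop 0).filter_mono inf_le_left).and
      ((eventually_principal.2 fun n hn => hn).filter_mono inf_le_right)
  filter_upwards [hev] with n ⟨hn, hnd⟩
  have hn' : (0 : ℝ) < n := by exact_mod_cast hn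
  apply one_sub_le_configProb hnd
  have hB0 : 0 ≤ β * n := by positivity
  have hfl : β * n ≤ (⌊β * n⌋₊ + 1 : ℕ) := by push_cast; exact (Nat.lt_floor_add_one _).le
  have hA := hC n hn hnd
  have hS := card_sparse_exists_le hnd hn hd (Nat.succ_pos ⌊β * n⌋₊) hη0 hη1 hL hε htδ hδ hη hfl
  rw [mul_add]
  have hmono : Real.exp (1 / 2 - ((⌊β * n⌋₊ + 1 : ℕ) : ℝ) * (Real.log d * (ε / 8))) ≤
      Real.exp (1 / 2 - c * n) := by
    apply Real.exp_le_exp.2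
    have := mul_le_mul_of_nonneg_right hfl (show 0 ≤ Real.log d * (ε / 8) by positivity)
    rw [hc]
    nlinarith
  refine le_trans ?_ (add_le_add hA (hS.trans
    (mul_le_mul_of_nonneg_left hmono (Nat.cast_nonneg _))))
  rw [← Nat.cast_add, Nat.cast_le]
  refine le_trans (Finset.card_le_card ?_) (Finset.card_union_le _ _)
  intro p hp
  have hp' := (Finset.mem_filter.1 hp).2
  push Not at hp'
  obtain ⟨S, hS1, hS2⟩ := hp'
  rcases exists_dense_or_sparse (t := t) p hB0 hS1 hS2 with h | h
  · exact Finset.mem_union_left _ (Finset.mem_filter.2 ⟨Finset.mem_univ _, h⟩)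
  · exact Finset.mem_union_right _ (Finset.mem_filter.2 ⟨Finset.mem_univ _, h⟩)

theorem theorem1 (εd : ℕ → ℝ) (hpos : ∀ d, 1 ≤ d → 0 < εd d) (hle : ∀ d, 1 ≤ d → εd d ≤ 1)
    (hlim : Tendsto εd atTop (𝓝 0)) (ε : ℝ) (hε : 0 < ε) :
    ∃ d₀ : ℕ, ∀ d : ℕ, d₀ ≤ d →
      ConfigWHP d (fun n G =>
        ∀ S : Set (Fin n),
          G.IsPercolationSet (εd d * (Real.log (d : ℝ) / (d : ℝ)) * (n : ℝ)) S →
            (S.ncard : ℝ) ≤ (2 + ε) * (Real.log (d : ℝ) / (d : ℝ)) * (n : ℝ)) := by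
  -- Solves η(1 + ε/2) = ε/4, so that `hη` holds with equality.
  set η : ℝ := ε / (4 + 2 * ε) with hηdef
  have hη0 : 0 < η := by positivity
  have hη1 : η < 1 := (div_lt_one (by positivity)).2 (by linarith)
  have hη : 1 + ε / 4 ≤ (1 - η) * (1 + ε / 2) := by
    have : η * (1 + ε / 2) = ε / 4 := by rw [hηdef]; field_simp; ring
    nlinarith
  have hlog : 0 < Real.log (1 / η) := Real.log_pos ((one_lt_div hη0).2 hη1)
  -- Makes 2δ log(1/η) = ε/8; the factor 2 absorbs the rounding in t = ⌈δL⌉ ≤ 2δL.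
  set δ : ℝ := ε / (16 * Real.log (1 / η)) with hδdef
  have hδ0 : 0 < δ := by positivity
  have hδ : 2 * δ * Real.log (1 / η) ≤ ε / 8 := by
    apply le_of_eq; rw [hδdef]; field_simp; norm_num
  have hlogd : Tendsto (fun d : ℕ => Real.log (d : ℝ)) atTop atTop :=
    Real.tendsto_log_atTop.comp tendsto_natCast_atTop_atTop
  have hev1 : ∀ᶠ d : ℕ in atTop, 8 ≤ δ * Real.log d :=
    (hlogd.const_mul_atTop hδ0).eventually_ge_atTop 8
  -- The only use of ε_d → 0. The threshold forces the base Y to be at most exp(-2/δ), and since t -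
  -- 1 ≥ δL/2 this gives Y^(t-1) ≤ exp(-L) = 1/d.
  have hev2 : ∀ᶠ d : ℕ in atTop, εd d < 2 * δ / Real.exp 1 * Real.exp (-(2 / δ)) :=
    hlim.eventually_lt_const (by positivity)
  obtain ⟨d₀, hd₀⟩ := eventually_atTop.1 (((hev1.and hev2).and
    (hlogd.eventually_ge_atTop 2)).and (eventually_gt_atTop 0))
  refine ⟨d₀, fun d hd => ?_⟩
  obtain ⟨⟨⟨h8, hεd⟩, hL⟩, hdpos⟩ := hd₀ d hd
  have hd' : (0 : ℝ) < d := by exact_mod_cast hdpos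
  have hεd0 := hpos d hdpos
  set L : ℝ := Real.log d with hLdef
  have hL0 : 0 < L := by linarith
  set t : ℕ := ⌈δ * L⌉₊ with ht
  have ht1 : δ * L ≤ t := Nat.le_ceil _
  have ht2 : (t : ℝ) ≤ 2 * δ * L := by
    have := Nat.ceil_lt_add_one (show 0 ≤ δ * L by positivity)
    linarith
  have ht8 : 8 ≤ t := by exact_mod_cast h8.trans ht1
  have ht0 : (0 : ℝ) < t := by linarith
  have hY : Real.exp 1 * (d * (εd d * (L / d)) / (2 * t)) ≤ Real.exp (-(2 / δ)) := by
    have h1 : d * (εd d * (L / d)) / (2 * t) ≤ εd d / (2 * δ) := by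
      rw [div_le_div_iff₀ (by positivity) (by positivity)]
      have e : d * (εd d * (L / d)) = εd d * L := by field_simp
      rw [e]
      nlinarith [mul_le_mul_of_nonneg_left ht1 hεd0.le]
    have h2 : Real.exp 1 * (εd d / (2 * δ)) ≤ Real.exp (-(2 / δ)) := by
      have e : Real.exp (-(2 / δ)) = Real.exp 1 *
          ((2 * δ / Real.exp 1 * Real.exp (-(2 / δ))) / (2 * δ)) := by
        field_simp
      rw [e]
      gcongr
    exact (mul_le_mul_of_nonneg_left h1 (Real.exp_pos 1).le).trans h2
  have hY0 : 0 ≤ Real.exp 1 * (d * (εd d * (L / d)) / (2 * t)) := by positivity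
  refine configWHP_of_parameters hdpos ht8 ?_ ?_ hη0 hη1.le hL hε ht2 hδ hη
  · exact hY.trans (Real.exp_le_one_iff.2 (by have : 0 < 2 / δ := by positivity
                                              linarith))
  · refine (pow_le_pow_left₀ hY0 hY _).trans ?_
    rw [← Real.exp_nat_mul]
    have e : (1 : ℝ) / d = Real.exp (-L) := by rw [Real.exp_neg, hLdef, Real.exp_log hd', one_div]
    rw [e]
    apply Real.exp_le_exp.2
    have h1 : ((t - 1 : ℕ) : ℝ) = t - 1 := by rw [Nat.cast_sub (by omega)]; simp
    have h2 : δ * L / 2 ≤ (t : ℝ) - 1 := by linarith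
    have h3 : L = δ * L / 2 * (2 / δ) := by field_simp
    have := mul_le_mul_of_nonneg_right h2 (show 0 ≤ 2 / δ by positivity)
    rw [h1]
    linarith
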